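/- Let $k\ge 2$ be an integer and write $(x;q)_n=\prod_{i=0}^{n-1}(1-xq^i)$, $(x;q)_\infty=\prod_{i\ge 0}(1-xq^i)$. All identities are between formal power series in $q$, and $a^n(-1/a;q)_n$ denotes the polynomial $\prod_{i=0}^{n-1}(a+q^i)$. For $m\in\mathbb Z$ and $n,j\ge 0$ define the integers $\overline N_k(m,n,j)$ by the following identity in $\mathbb Z[a][[q]]$: $$\sum_{n=0}^\infty\sum_{j=0}^\infty\overline N_k(m,n,j)a^jq^n=\frac{(-aq;q)_\infty}{(q;q)_\infty}\sum_{n=1}^\infty(-1)^{n-1}a^nq^{(k-1)n^2+|m|n}(1-q^n)\frac{(-1/a;q)_n}{(-aq;q)_n}.$$ Then, in $\mathbb Z[a][z,z^{-1}][[q]]$, both of the following sums converge (coefficientwise in $q$) and $$\sum_{m=-\infty}^\infty\sum_{n=0}^\infty\sum_{j=0}^\infty\overline N_k(m,n,j)a^jq^nz^m=\sum_{n_1\ge\cdots\ge n_{k-1}\ge1}\frac{a^{n_1}q^{\binom{n_1+1}{2}+n_2^2+\cdots+n_{k-1}^2}(-1/a;q)_{n_1}}{(q;q)_{n_1-n_2}\cdots(q;q)_{n_{k-2}-n_{k-1}}\,(zq;q)_{n_{k-1}}(z^{-1}q;q)_{n_{k-1}}}.$$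 (For $k=2$ the sum is over $n_1\ge 1$, with $q$-exponent $\binom{n_1+1}{2}$ and denominator $(zq;q)_{n_1}(z^{-1}q;q)_{n_1}$.) -/

import Mathlib

/-! Formal `q`-series.  The base `q` is always the power series variable `PowerSeries.X`. -/

/-- The `q`-adic (coefficientwise) topology on `R⟦q⟧`: the topology of coefficientwise convergence
for the discrete topology on `R`.  All infinite sums and products below are taken in it. -/
@[reducible]
def qAdicTopology (R : Type*) [Semiring R] : TopologicalSpace (PowerSeries R) :=
  @PowerSeries.WithPiTopology.instTopologicalSpace R ⊥

attribute [local instance] qAdicTopology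

/-- `(x; q)_n = ∏_{i=0}^{n-1} (1 - x q^i)`. -/
noncomputable def qPoch {R : Type*} [CommRing R] (x : PowerSeries R) (n : ℕ) : PowerSeries R :=
  ∏ i ∈ Finset.range n, (1 - x * PowerSeries.X ^ i)

/-- `(x; q)_∞ = ∏_{i≥0} (1 - x q^i)`, an infinite product of formal power series in `q`. -/
noncomputable def qPochInf {R : Type*} [CommRing R] (x : PowerSeries R) : PowerSeries R :=
  ∏' i : ℕ, (1 - x * PowerSeries.X ^ i)

/-- `a^n (-1/a; q)_n = ∏_{i=0}^{n-1} (a + q^i)`, which is a polynomial in `a`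
(see `scaledPoch_eq` for invertible `a`). -/
noncomputable def scaledPoch {R : Type*} [CommRing R] (a : PowerSeries R) (n : ℕ) :
    PowerSeries R :=
  ∏ i ∈ Finset.range n, (a + PowerSeries.X ^ i)

/-- The inverse `1/f` of a formal power series `f` with constant coefficient `1`. -/
noncomputable def recip {R : Type*} [CommRing R] (f : PowerSeries R) : PowerSeries R :=
  PowerSeries.invOfUnit f 1

/-- For invertible `a`, `scaledPoch a n` is literally `a^n (-1/a; q)_n`. -/
theorem scaledPoch_eq {R : Type*} [CommRing R] (a : (PowerSeries R)ˣ) (n : ℕ) :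
    scaledPoch (a : PowerSeries R) n
      = (a : PowerSeries R) ^ n * qPoch (-((a⁻¹ : (PowerSeries R)ˣ) : PowerSeries R)) n := by
  have h : ∀ i : ℕ, (a : PowerSeries R) + PowerSeries.X ^ i
      = (a : PowerSeries R) * (1 - -((a⁻¹ : (PowerSeries R)ˣ) : PowerSeries R) * PowerSeries.X ^ i) := by
    intro i
    rw [neg_mul, sub_neg_eq_add, mul_add, ← mul_assoc, Units.mul_inv]
    ring
  simp only [scaledPoch, qPoch, h, Finset.prod_mul_distrib, Finset.prod_const, Finset.card_range]

theorem mul_recip {R : Type*} [CommRing R] (f : PowerSeries R)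
    (hf : PowerSeries.constantCoeff f = 1) : f * recip f = 1 :=
  PowerSeries.mul_invOfUnit f 1 (by simpa using hf)

theorem constantCoeff_qPoch {R : Type*} [CommRing R] (x : PowerSeries R)
    (hx : PowerSeries.constantCoeff x = 0) (n : ℕ) :
    PowerSeries.constantCoeff (qPoch x n) = 1 := by
  simp [qPoch, map_prod, hx]

/-- The infinite product defining `(x; q)_∞` converges `q`-adically. -/
theorem multipliable_qPochInf {R : Type*} [CommRing R] (x : PowerSeries R) :
    Multipliable fun i : ℕ => (1 - x * PowerSeries.X ^ i : PowerSeries R) := by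
  let _ : TopologicalSpace R := ⊥
  simp only [sub_eq_add_neg]
  apply PowerSeries.WithPiTopology.multipliable_one_add_of_tendsto_order_atTop_nhds_top
  rw [ENat.tendsto_nhds_top_iff_natCast_lt]
  intro n
  filter_upwards [Filter.eventually_gt_atTop n] with i hi
  refine lt_of_lt_of_le (Nat.cast_lt.mpr hi) ?_
  apply PowerSeries.nat_le_order
  intro j hj
  rw [map_neg, PowerSeries.coeff_mul_X_pow', if_neg (by omega), neg_zero]

/-- The term of index `n ≥ 1` in the Lambert-type series below, over `ℤ[a]⟦q⟧`:
`(-1)^{n-1} a^n q^{(k-1)n²+|m|n} (1-q^n) (-1/a;q)_n / (-aq;q)_n`. -/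
noncomputable def lambertTerm (k : ℕ) (m : ℤ) (n : ℕ) : PowerSeries (Polynomial ℤ) :=
  (-1) ^ (n - 1) * PowerSeries.X ^ ((k - 1) * n ^ 2 + m.natAbs * n) * (1 - PowerSeries.X ^ n)
    * scaledPoch (PowerSeries.C Polynomial.X) n
    * recip (qPoch (-(PowerSeries.C Polynomial.X * PowerSeries.X)) n)

/-- For `k ≥ 2`, the series in `ℤ[a]⟦q⟧`
`(-aq;q)_∞/(q;q)_∞ · ∑_{n≥1} (-1)^{n-1} a^n q^{(k-1)n²+|m|n} (1-q^n) (-1/a;q)_n/(-aq;q)_n`. -/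
noncomputable def overRankSeries (k : ℕ) (m : ℤ) : PowerSeries (Polynomial ℤ) :=
  qPochInf (-(PowerSeries.C Polynomial.X * PowerSeries.X)) * recip (qPochInf PowerSeries.X)
    * ∑' n : ℕ, lambertTerm k m (n + 1)

/-- The coefficient of `a^j q^n` in `overRankSeries k m`. -/
noncomputable def overRankCount (k : ℕ) (m : ℤ) (n j : ℕ) : ℤ :=
  (PowerSeries.coeff n (overRankSeries k m)).coeff j

/-- The Lambert-type series converges `q`-adically. -/
theorem summable_lambertTerm (k : ℕ) (hk : 2 ≤ k) (m : ℤ) :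
    Summable fun n : ℕ => lambertTerm k m (n + 1) := by
  let _ : TopologicalSpace (Polynomial ℤ) := ⊥
  apply PowerSeries.WithPiTopology.summable_of_tendsto_order_atTop_nhds_top
  rw [ENat.tendsto_nhds_top_iff_natCast_lt]
  intro N
  filter_upwards [Filter.eventually_ge_atTop N] with n hn
  refine lt_of_lt_of_le (Nat.cast_lt.mpr (Nat.lt_succ_of_le hn)) ?_
  apply PowerSeries.nat_le_order
  intro j hj
  have h1 : n + 1 ≤ (k - 1) * (n + 1) ^ 2 + m.natAbs * (n + 1) := by
    have : 1 ≤ k - 1 := by omega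
    nlinarith [Nat.zero_le (m.natAbs * (n + 1)), Nat.zero_le n,
      Nat.mul_le_mul this (le_refl ((n + 1) ^ 2))]
  have h2 : lambertTerm k m (n + 1) = ((-1) ^ (n + 1 - 1) * (1 - PowerSeries.X ^ (n + 1))
      * scaledPoch (PowerSeries.C Polynomial.X) (n + 1)
      * recip (qPoch (-(PowerSeries.C Polynomial.X * PowerSeries.X)) (n + 1)))
      * PowerSeries.X ^ ((k - 1) * (n + 1) ^ 2 + m.natAbs * (n + 1)) := by
    rw [lambertTerm]; ring
  rw [h2, PowerSeries.coeff_mul_X_pow', if_neg (by omega)]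

/-- `ℤ[a][z, z⁻¹]⟦q⟧`, where the generating functions in the three variables `a`, `z`, `q` live. -/
abbrev GenSeries : Type := PowerSeries (LaurentPolynomial (Polynomial ℤ))

/-- The variable `a`. -/
noncomputable def aVar : GenSeries := PowerSeries.C (LaurentPolynomial.C Polynomial.X)

/-- The variable `q`. -/
noncomputable def qVar : GenSeries := PowerSeries.X

/-- The power `z^m`, `m ∈ ℤ`, of the variable `z`. -/
noncomputable def zPow (m : ℤ) : GenSeries := PowerSeries.C (LaurentPolynomial.T m)

/-- The tuples `n_1 ≥ n_2 ≥ ⋯ ≥ n_{r+1} ≥ 1`, where `n i` stands for `n_{i+1}`. -/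
abbrev ChainIndex (r : ℕ) : Type := {n : Fin (r + 1) → ℕ // Antitone n ∧ ∀ i, 1 ≤ n i}

/-- With `r = k - 2` and `n_1 ≥ ⋯ ≥ n_{k-1}` (`n i` standing for `n_{i+1}`), the term
`a^{n_1} q^{binom(n_1+1, 2) + n_2² + ⋯ + n_{k-1}²} (-1/a;q)_{n_1}` divided by
`(q;q)_{n_1-n_2} ⋯ (q;q)_{n_{k-2}-n_{k-1}} (zq;q)_{n_{k-1}} (z⁻¹q;q)_{n_{k-1}}`. -/
noncomputable def multisumTerm (r : ℕ) (n : Fin (r + 1) → ℕ) : GenSeries :=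
  scaledPoch aVar (n 0) * qVar ^ ((n 0 + 1).choose 2 + ∑ i : Fin r, n i.succ ^ 2)
    * recip ((∏ i : Fin r, qPoch qVar (n i.castSucc - n i.succ))
        * (qPoch (zPow 1 * qVar) (n (Fin.last r)) * qPoch (zPow (-1) * qVar) (n (Fin.last r))))

/-! The proof is a Bailey chain argument relative to `1`. Put β_n = 1/((zq;q)_n (z⁻¹q;q)_n) for n ≥
1 and α_s = (-1)^{s-1} q^{binom(s,2)} (1-q^s)(1-q^{2s}) / ((1-zq^s)(1-z⁻¹q^s)) for s ≥ 1. Then β_n =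
∑_{s=1}^n α_s / ((q;q)_{n-s} (q;q)_{n+s}) by `recip_qPoch_mul_qPoch`; there is no α_0, which suits
chains whose entries are all positive. Each inner summation, with weight
q^{n_i²}/(q;q)_{n_{i-1}-n_i}, only multiplies α_s by q^{s²} (`bailey_step`), so the sum over chains
with fixed n_1 collapses to a single sum (`sum_chainWeight`).

The remaining sum over n_1 is a limiting `q`-Gauss sum (`hasSum_conjugate_bailey`), which produces
(-aq;q)_∞/(q;q)_∞ and a factor q^{binom(s+1,2)}. Since binom(s,2) + binom(s+1,2) = s², the exponent
becomes (k-1)s². Expanding (1-q^{2s})/((1-zq^s)(1-z⁻¹q^s)) = ∑_m z^m q^{|m|s}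
(`hasSum_bilateral_geometric`) and collecting powers of z recovers the defining Lambert-type series.
Sums may be interchanged because only finitely many terms reach a given coefficient of q. -/

/-! ### Convergence in the `q`-adic topology. -/

section FormalTopology

variable {R : Type*} [CommRing R]

instance qAdic_t2Space : T2Space (PowerSeries R) :=
  let _ : TopologicalSpace R := ⊥
  have : DiscreteTopology R := ⟨rfl⟩
  PowerSeries.WithPiTopology.instT2Space R

instance qAdic_isTopologicalRing : IsTopologicalRing (PowerSeries R) :=
  let _ : TopologicalSpace R := ⊥
  have : DiscreteTopology R := ⟨rfl⟩
  PowerSeries.WithPiTopology.instIsTopologicalRing R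

/-- A family converges `q`-adically when every coefficient is eventually constant. -/
theorem qAdic_tendsto {ι : Type*} {l : Filter ι} {f : ι → PowerSeries R} {g : PowerSeries R}
    (h : ∀ d, ∀ᶠ i in l, PowerSeries.coeff d (f i) = PowerSeries.coeff d g) :
    Filter.Tendsto f l (nhds g) := by
  let _ : TopologicalSpace R := ⊥
  have : DiscreteTopology R := ⟨rfl⟩
  rw [PowerSeries.WithPiTopology.tendsto_iff_coeff_tendsto]
  intro d
  exact (tendsto_const_nhds).congr' ((h d).mono fun i hi => hi.symm)

theorem qAdic_summable {ι : Type*} {f : ι → PowerSeries R}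
    (h : ∀ d, {i | PowerSeries.coeff d (f i) ≠ 0}.Finite) : Summable f := by
  let _ : TopologicalSpace R := ⊥
  rw [PowerSeries.WithPiTopology.summable_iff_summable_coeff]
  exact fun d => summable_of_hasFiniteSupport (h d)

/-- Divisibility by growing powers of `q` gives summability. -/
theorem qAdic_summable_of_dvd {ι : Type*} {f : ι → PowerSeries R} (e : ι → ℕ)
    (he : ∀ d, {i | e i ≤ d}.Finite) (h : ∀ i, PowerSeries.X ^ e i ∣ f i) : Summable f := by
  refine qAdic_summable fun d => (he d).subset fun i hi => ?_
  by_contra hd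
  exact hi (PowerSeries.X_pow_dvd_iff.1 (h i) d (not_le.1 hd))

theorem qAdic_dvd_hasSum {ι : Type*} {f : ι → PowerSeries R} {g : PowerSeries R} {n : ℕ}
    (hf : HasSum f g) (h : ∀ i, PowerSeries.X ^ n ∣ f i) : PowerSeries.X ^ n ∣ g := by
  let _ : TopologicalSpace R := ⊥
  have : DiscreteTopology R := ⟨rfl⟩
  rw [PowerSeries.X_pow_dvd_iff]
  intro d hd
  have h1 := PowerSeries.WithPiTopology.hasSum_iff_hasSum_coeff R |>.1 hf d
  simp only [fun i => PowerSeries.X_pow_dvd_iff.1 (h i) d hd] at h1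
  exact h1.unique hasSum_zero

theorem qAdic_tendsto_of_dvd {f : ℕ → PowerSeries R} {g : PowerSeries R}
    (h : ∀ n, PowerSeries.X ^ n ∣ f n - g) : Filter.Tendsto f Filter.atTop (nhds g) := by
  refine qAdic_tendsto fun d => ?_
  filter_upwards [Filter.eventually_gt_atTop d] with n hn
  have := PowerSeries.X_pow_dvd_iff.1 (h n) d hn
  rwa [map_sub, sub_eq_zero] at this

theorem qAdic_continuous_map {S : Type*} [CommRing S] (φ : R →+* S) :
    Continuous (PowerSeries.map φ) := by
  let _ : TopologicalSpace R := ⊥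
  have : DiscreteTopology R := ⟨rfl⟩
  let _ : TopologicalSpace S := ⊥
  rw [continuous_iff_continuousAt]
  intro x
  refine (PowerSeries.WithPiTopology.tendsto_iff_coeff_tendsto S _ _ _).2 fun d => ?_
  simp only [PowerSeries.coeff_map]
  exact ((continuous_of_discreteTopology (f := φ)).comp
    (PowerSeries.WithPiTopology.continuous_coeff R d)).continuousAt

theorem qAdic_hasSum_coeff_mul_X_pow (f : PowerSeries R) :
    HasSum (fun n => PowerSeries.C (PowerSeries.coeff n f) * PowerSeries.X ^ n) f := by
  let _ : TopologicalSpace R := ⊥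
  have := PowerSeries.hasSum_of_monomials_self f
  simpa only [PowerSeries.monomial_eq_mk, ← PowerSeries.monomial_eq_C_mul_X_pow] using this

end FormalTopology

/-! ### Reciprocals and finite `q`-factorials. -/

section Recip

variable {R : Type*} [CommRing R]

theorem recip_eq_of_mul_eq_one {f g : PowerSeries R} (hf : PowerSeries.constantCoeff f = 1)
    (h : f * g = 1) : recip f = g := by
  calc recip f = (f * g) * recip f := by rw [h, one_mul]
    _ = (f * recip f) * g := by ring
    _ = g := by rw [mul_recip f hf, one_mul]

theorem recip_mul {f g : PowerSeries R} (hf : PowerSeries.constantCoeff f = 1)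
    (hg : PowerSeries.constantCoeff g = 1) : recip (f * g) = recip f * recip g := by
  refine recip_eq_of_mul_eq_one (by simp [hf, hg]) ?_
  rw [mul_mul_mul_comm, mul_recip f hf, mul_recip g hg, one_mul]

theorem recip_one : recip (1 : PowerSeries R) = 1 :=
  recip_eq_of_mul_eq_one (by simp) (by simp)

theorem map_recip {S : Type*} [CommRing S] (φ : R →+* S) {f : PowerSeries R}
    (hf : PowerSeries.constantCoeff f = 1) :
    PowerSeries.map φ (recip f) = recip (PowerSeries.map φ f) := by
  refine (recip_eq_of_mul_eq_one ?_ ?_).symm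
  · rw [← PowerSeries.coeff_zero_eq_constantCoeff_apply, PowerSeries.coeff_map,
      PowerSeries.coeff_zero_eq_constantCoeff_apply, hf, map_one]
  · rw [← map_mul, mul_recip f hf, map_one]

theorem constantCoeff_qPoch_mul_X (x : PowerSeries R) (n : ℕ) :
    PowerSeries.constantCoeff (qPoch (x * PowerSeries.X) n) = 1 :=
  constantCoeff_qPoch _ (by simp) n

theorem isUnit_one_sub_X_pow_succ (n : ℕ) :
    IsUnit (1 - PowerSeries.X ^ (n + 1) : PowerSeries R) := by
  rw [PowerSeries.isUnit_iff_constantCoeff]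
  simp

theorem qPoch_add (x : PowerSeries R) (m n : ℕ) :
    qPoch x (m + n) = qPoch x m * qPoch (x * PowerSeries.X ^ m) n := by
  simp only [qPoch, Finset.prod_range_add, pow_add, mul_assoc]

theorem qPoch_succ (x : PowerSeries R) (n : ℕ) :
    qPoch x (n + 1) = qPoch x n * (1 - x * PowerSeries.X ^ n) := by
  simp only [qPoch, Finset.prod_range_succ]

theorem qPoch_zero (x : PowerSeries R) : qPoch x 0 = 1 := by simp [qPoch]

/-- `1/(q; q)_n`. -/
noncomputable def invQFactorial (R : Type*) [CommRing R] (n : ℕ) : PowerSeries R :=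
  recip (qPoch PowerSeries.X n)

theorem constantCoeff_qPoch_X (n : ℕ) :
    PowerSeries.constantCoeff (qPoch (PowerSeries.X : PowerSeries R) n) = 1 :=
  constantCoeff_qPoch _ (by simp) n

theorem qPoch_mul_invQFactorial (n : ℕ) : qPoch PowerSeries.X n * invQFactorial R n = 1 :=
  mul_recip _ (constantCoeff_qPoch_X n)

theorem invQFactorial_zero : invQFactorial R 0 = 1 := by
  rw [invQFactorial, qPoch_zero, recip_one]

theorem invQFactorial_eq_succ (n : ℕ) :
    invQFactorial R n = (1 - PowerSeries.X ^ (n + 1)) * invQFactorial R (n + 1) := by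
  refine recip_eq_of_mul_eq_one (constantCoeff_qPoch_X n) ?_
  have h := qPoch_mul_invQFactorial (R := R) (n + 1)
  rwa [qPoch_succ, ← pow_succ', mul_assoc] at h

end Recip

/-! ### The Bailey chain and the Bailey pair for the rank denominator. -/

section FiniteIdentities

variable {R : Type*} [CommRing R]

open PowerSeries in
/-- A limiting case of the `q`-Chu–Vandermonde sum. -/
theorem sum_qVandermonde (N m : ℕ) :
    ∑ t ∈ Finset.range (N + 1), X ^ (t ^ 2 + m * t) * invQFactorial R (N - t)
        * invQFactorial R t * invQFactorial R (t + m)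
      = invQFactorial R N * invQFactorial R (N + m) := by
  induction N generalizing m with
  | zero => simp [invQFactorial_zero]
  | succ N ih =>
    apply (isUnit_one_sub_X_pow_succ N).mul_left_cancel
    -- Split 1 - q^{N+1} = q^t (1 - q^{N+1-t}) + (1 - q^t). After shifting t in the second part, the
    -- two parts recombine into the case of N with m + 1, hence the induction over all m.
    have hsplit : ∀ t ∈ Finset.range (N + 1 + 1),
        (1 - X ^ (N + 1)) * (X ^ (t ^ 2 + m * t) * invQFactorial R (N + 1 - t)
          * invQFactorial R t * invQFactorial R (t + m))
        = X ^ (t ^ 2 + (m + 1) * t) * ((1 - X ^ (N + 1 - t)) * invQFactorial R (N + 1 - t))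
            * invQFactorial R t * invQFactorial R (t + m)
          + X ^ (t ^ 2 + m * t) * invQFactorial R (N + 1 - t)
            * ((1 - X ^ t) * invQFactorial R t) * invQFactorial R (t + m) := by
      intro t ht
      have : N + 1 = (N + 1 - t) + t := by have := Finset.mem_range.1 ht; omega
      have e : (X : PowerSeries R) ^ (N + 1) = X ^ (N + 1 - t) * X ^ t := by
        rw [← pow_add, ← this]
      rw [e]
      ring
    rw [Finset.mul_sum, Finset.sum_congr rfl hsplit, Finset.sum_add_distrib,
      Finset.sum_range_succ, Finset.sum_range_succ' (fun t => X ^ (t ^ 2 + m * t) *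
        invQFactorial R (N + 1 - t) * ((1 - X ^ t) * invQFactorial R t) * invQFactorial R (t + m))]
    simp only [Nat.sub_self, pow_zero, sub_self, zero_mul, mul_zero, add_zero]
    rw [← mul_assoc, ← invQFactorial_eq_succ, show N + 1 + m = N + (m + 1) by ring, ← ih (m + 1),
      ← Finset.sum_add_distrib]
    refine Finset.sum_congr rfl fun t ht => ?_
    obtain ⟨k, rfl⟩ : ∃ k, N = t + k := Nat.exists_eq_add_of_le (by
      have := Finset.mem_range.1 ht; omega)
    rw [show t + k + 1 - t = k + 1 by omega, show t + k + 1 - (t + 1) = k by omega,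
      show t + k - t = k by omega, ← invQFactorial_eq_succ, ← invQFactorial_eq_succ,
      invQFactorial_eq_succ (t + m), show t + 1 + m = t + m + 1 by ring,
      show t + (m + 1) = t + m + 1 by ring]
    ring

open PowerSeries in
/-- One step of the Bailey chain relative to `1`, both parameters tending to infinity.
The index `r` of `α` and `β` is shifted by one. -/
theorem bailey_step (α : ℕ → PowerSeries R) (n : ℕ) :
    ∑ j ∈ Finset.range n, X ^ ((j + 1) ^ 2) * invQFactorial R (n - (j + 1))
        * ∑ r ∈ Finset.range (j + 1),
            α r * invQFactorial R (j + 1 - (r + 1)) * invQFactorial R (j + 1 + (r + 1))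
      = ∑ r ∈ Finset.range n, X ^ ((r + 1) ^ 2) * α r
          * invQFactorial R (n - (r + 1)) * invQFactorial R (n + (r + 1)) := by
  simp only [Finset.mul_sum]
  -- With j = r + t, (j+1)² = (r+1)² + t² + 2(r+1)t, so the inner sum over t is `sum_qVandermonde`
  -- with m = 2(r+1).
  rw [Finset.sum_comm' (t' := Finset.range n) (s' := fun r => Finset.Ico r n) (by
    intro x y; simp only [Finset.mem_range, Finset.mem_Ico]; omega)]
  refine Finset.sum_congr rfl fun r hr => ?_
  obtain ⟨N, rfl⟩ : ∃ N, n = r + 1 + N := Nat.exists_eq_add_of_le (Finset.mem_range.1 hr)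
  rw [Finset.sum_Ico_eq_sum_range, show r + 1 + N - r = N + 1 by omega,
    show r + 1 + N - (r + 1) = N by omega,
    show r + 1 + N + (r + 1) = N + 2 * (r + 1) by ring, mul_assoc, ← sum_qVandermonde,
    Finset.mul_sum]
  refine Finset.sum_congr rfl fun t ht => ?_
  rw [show r + 1 + N - (r + t + 1) = N - t by omega, show r + t + 1 - (r + 1) = t by omega,
    show r + t + 1 + (r + 1) = t + 2 * (r + 1) by ring]
  ring

open PowerSeries in
-- The factor 1 - q^{n-1} makes the partial sums closed products, so the sum telescopes.
theorem partialSum_bailey_remainder (n s : ℕ) (h : s + 1 ≤ n) :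
    (1 - X ^ (n - 1)) * ∑ r ∈ Finset.range s, X ^ (n - (r + 1)) * ((-1) ^ r * X ^ ((r + 1).choose 2)
        * (1 - X ^ (r + 1)) * (1 - X ^ (2 * (r + 1))))
        * invQFactorial R (n - (r + 1)) * invQFactorial R (n + (r + 1))
      = (-1) ^ (s + 1) * X ^ ((s + 1).choose 2) * X ^ (n - (s + 1)) * (1 - X ^ s) * (1 - X ^ (s + 1))
        * invQFactorial R (n - (s + 1)) * invQFactorial R (n + s) := by
  induction s with
  | zero => simp
  | succ s ih =>
    rw [Finset.sum_range_succ, mul_add, ih (by omega)]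
    obtain ⟨k, rfl⟩ : ∃ k, n = s + 1 + 1 + k := Nat.exists_eq_add_of_le h
    rw [show s + 1 + 1 + k - (s + 1 + 1) = k by omega,
      show s + 1 + 1 + k - (s + 1) = k + 1 by omega,
      show s + 1 + 1 + k - 1 = s + k + 1 by omega, invQFactorial_eq_succ k,
      invQFactorial_eq_succ (s + 1 + 1 + k + s), ← add_assoc (s + 1 + 1 + k) s 1,
      Nat.choose_succ_succ' (s + 1) 1, Nat.choose_one_right]
    ring

open PowerSeries in
-- The closed form for all terms but the last cancels the last one. The index starts at 2 because
-- for index 1 the sum equals 1.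
theorem sum_bailey_remainder (n : ℕ) :
    ∑ r ∈ Finset.range (n + 2), X ^ (n + 2 - (r + 1)) * ((-1) ^ r * X ^ ((r + 1).choose 2)
        * (1 - X ^ (r + 1)) * (1 - X ^ (2 * (r + 1))))
        * invQFactorial R (n + 2 - (r + 1)) * invQFactorial R (n + 2 + (r + 1)) = 0 := by
  apply (isUnit_one_sub_X_pow_succ n).mul_left_cancel
  have h := partialSum_bailey_remainder (R := R) (n + 2) (n + 1) le_rfl
  rw [Finset.sum_range_succ, mul_add]
  rw [show n + 2 - 1 = n + 1 by omega] at h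
  rw [h, invQFactorial_eq_succ (n + 2 + (n + 1)), ← add_assoc (n + 2) (n + 1) 1,
    show n + 1 + 1 = n + 2 by ring, Nat.sub_self]
  ring

open PowerSeries in
/-- The factor `(1 - z q^n)(1 - z⁻¹ q^n)`. -/
noncomputable def rankFactor (z z' : PowerSeries R) (n : ℕ) : PowerSeries R :=
  (1 - z * X ^ n) * (1 - z' * X ^ n)

open PowerSeries in
theorem constantCoeff_rankFactor (z z' : PowerSeries R) (n : ℕ) :
    constantCoeff (rankFactor z z' (n + 1)) = 1 := by
  simp [rankFactor]

open PowerSeries in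
/-- The Bailey sequence whose partner is `1 / ((zq; q)_n (z⁻¹q; q)_n)`, indexed from `n = 1`. -/
noncomputable def rankAlpha (z z' : PowerSeries R) (r : ℕ) : PowerSeries R :=
  (-1) ^ r * X ^ ((r + 1).choose 2) * (1 - X ^ (r + 1)) * (1 - X ^ (2 * (r + 1)))
    * recip (rankFactor z z' (r + 1))

open PowerSeries in
-- Both rank factors are linear in z + z⁻¹; scaling by q^k matches those parts, and what remains is
-- free of z.
theorem rankFactor_shift {z z' : PowerSeries R} (hz : z * z' = 1) (n k : ℕ) :
    rankFactor z z' (n + k)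
      = X ^ k * rankFactor z z' n + (1 - X ^ k) * (1 - X ^ (2 * n + k)) := by
  simp only [rankFactor]
  linear_combination (X ^ (2 * (n + k)) - X ^ (2 * n + k)) * hz

open PowerSeries in
-- The recurrence for β. In `rankFactor_shift`, the first summand cancels the denominator of α and
-- leaves a remainder without z; the second lowers both `q`-factorials, turning n + 1 into n.
theorem rankFactor_mul_sum_rankAlpha {z z' : PowerSeries R} (hz : z * z' = 1) (n : ℕ) :
    rankFactor z z' (n + 1) * ∑ r ∈ Finset.range (n + 1), rankAlpha z z' r
        * invQFactorial R (n + 1 - (r + 1)) * invQFactorial R (n + 1 + (r + 1))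
      = (∑ r ∈ Finset.range n, rankAlpha z z' r
          * invQFactorial R (n - (r + 1)) * invQFactorial R (n + (r + 1)))
        + ∑ r ∈ Finset.range (n + 1), X ^ (n + 1 - (r + 1)) * ((-1) ^ r * X ^ ((r + 1).choose 2)
          * (1 - X ^ (r + 1)) * (1 - X ^ (2 * (r + 1))))
          * invQFactorial R (n + 1 - (r + 1)) * invQFactorial R (n + 1 + (r + 1)) := by
  have key : ∀ r ∈ Finset.range (n + 1), rankFactor z z' (n + 1) * (rankAlpha z z' r
        * invQFactorial R (n + 1 - (r + 1)) * invQFactorial R (n + 1 + (r + 1)))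
      = rankAlpha z z' r * ((1 - X ^ (n - r)) * invQFactorial R (n + 1 - (r + 1)))
          * invQFactorial R (n + (r + 1))
        + X ^ (n + 1 - (r + 1)) * ((-1) ^ r * X ^ ((r + 1).choose 2)
          * (1 - X ^ (r + 1)) * (1 - X ^ (2 * (r + 1))))
          * invQFactorial R (n + 1 - (r + 1)) * invQFactorial R (n + 1 + (r + 1)) := by
    intro r hr
    obtain ⟨k, rfl⟩ : ∃ k, n = r + k := Nat.exists_eq_add_of_le (by
      have := Finset.mem_range.1 hr; omega)
    have hd := mul_recip _ (constantCoeff_rankFactor z z' r)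
    rw [show r + k + 1 - (r + 1) = k by omega, show r + k - r = k by omega,
      show r + k + 1 = r + 1 + k by ring, rankFactor_shift hz,
      show r + k + (r + 1) = 2 * r + 1 + k by ring,
      show r + 1 + k + (r + 1) = 2 * r + 1 + k + 1 by ring, invQFactorial_eq_succ (2 * r + 1 + k),
      rankAlpha]
    linear_combination X ^ k * ((-1) ^ r * X ^ ((r + 1).choose 2)
          * (1 - X ^ (r + 1)) * (1 - X ^ (2 * (r + 1)))) * invQFactorial R k
          * invQFactorial R (2 * r + 1 + k + 1) * hd
  rw [Finset.mul_sum, Finset.sum_congr rfl key, Finset.sum_add_distrib, Finset.sum_range_succ]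
  simp only [Nat.sub_self, pow_zero, sub_self, zero_mul, mul_zero, add_zero]
  congr 1
  refine Finset.sum_congr rfl fun r hr => ?_
  obtain ⟨k, rfl⟩ : ∃ k, n = r + 1 + k := Nat.exists_eq_add_of_le (by
      have := Finset.mem_range.1 hr; omega)
  rw [show r + 1 + k + 1 - (r + 1) = k + 1 by omega, show r + 1 + k - r = k + 1 by omega,
    show r + 1 + k - (r + 1) = k by omega, ← invQFactorial_eq_succ]

open PowerSeries in
/-- Partial fraction expansion of `1 / ((zq; q)_n (z⁻¹q; q)_n)` for `n ≥ 1`. -/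
theorem recip_qPoch_mul_qPoch {z z' : PowerSeries R} (hz : z * z' = 1) (n : ℕ) :
    recip (qPoch (z * X) (n + 1) * qPoch (z' * X) (n + 1))
      = ∑ r ∈ Finset.range (n + 1), rankAlpha z z' r
        * invQFactorial R (n + 1 - (r + 1)) * invQFactorial R (n + 1 + (r + 1)) := by
  refine recip_eq_of_mul_eq_one (by simp [constantCoeff_qPoch_mul_X]) ?_
  have hstep : ∀ n, qPoch (z * X) (n + 1) * qPoch (z' * X) (n + 1)
      = (qPoch (z * X) n * qPoch (z' * X) n) * rankFactor z z' (n + 1) := by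
    intro n
    rw [qPoch_succ, qPoch_succ, rankFactor, pow_succ']
    ring
  induction n with
  | zero =>
    rw [hstep, mul_assoc, rankFactor_mul_sum_rankAlpha hz, qPoch_zero, qPoch_zero]
    -- At n = 1 the remainder does not vanish: it is (1-q)(1-q²)/(q;q)_2 = 1, which starts the
    -- recurrence.
    have h2 := qPoch_mul_invQFactorial (R := R) 2
    rw [qPoch_succ, qPoch_succ, qPoch_zero] at h2
    simp [invQFactorial_zero]
    linear_combination h2
  | succ n ih =>
    rw [hstep, mul_assoc, rankFactor_mul_sum_rankAlpha hz, sum_bailey_remainder, add_zero, ih]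

end FiniteIdentities

/-! ### Infinite products as limits, and change of coefficients. -/

section InfiniteProduct

variable {R : Type*} [CommRing R]

theorem tendsto_qPoch (x : PowerSeries R) :
    Filter.Tendsto (qPoch x) Filter.atTop (nhds (qPochInf x)) :=
  (multipliable_qPochInf x).hasProd.tendsto_prod_nat

theorem qPochInf_eq_mul (x : PowerSeries R) (n : ℕ) :
    qPochInf x = qPoch x n * qPochInf (x * PowerSeries.X ^ n) := by
  refine tendsto_nhds_unique ((tendsto_qPoch x).comp (Filter.tendsto_add_atTop_nat n)) ?_
  refine ((tendsto_qPoch (x * PowerSeries.X ^ n)).const_mul (qPoch x n)).congr fun N => ?_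
  rw [Function.comp_apply, add_comm N n, qPoch_add]

open PowerSeries in
theorem constantCoeff_qPochInf {x : PowerSeries R} (hx : constantCoeff x = 0) :
    constantCoeff (qPochInf x) = 1 := by
  let _ : TopologicalSpace R := ⊥
  have : DiscreteTopology R := ⟨rfl⟩
  refine tendsto_nhds_unique (((WithPiTopology.continuous_constantCoeff R).tendsto _).comp
    (tendsto_qPoch x)) (tendsto_const_nhds.congr fun n => ?_)
  rw [Function.comp_apply, constantCoeff_qPoch x hx]

open PowerSeries in
theorem map_qPoch {S : Type*} [CommRing S] (φ : R →+* S) (x : PowerSeries R) (n : ℕ) :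
    map φ (qPoch x n) = qPoch (map φ x) n := by
  simp [qPoch, map_prod]

open PowerSeries in
theorem map_scaledPoch {S : Type*} [CommRing S] (φ : R →+* S) (x : PowerSeries R) (n : ℕ) :
    map φ (scaledPoch x n) = scaledPoch (map φ x) n := by
  simp [scaledPoch, map_prod]

open PowerSeries in
theorem map_qPochInf {S : Type*} [CommRing S] (φ : R →+* S) (x : PowerSeries R) :
    map φ (qPochInf x) = qPochInf (map φ x) := by
  refine tendsto_nhds_unique (((qAdic_continuous_map φ).tendsto _).comp (tendsto_qPoch x))
    ((tendsto_qPoch _).congr fun n => ?_)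
  rw [Function.comp_apply, map_qPoch]

end InfiniteProduct

/-! ### A limiting `q`-Gauss sum and the conjugate Bailey pair. -/

section ConjugateBailey

variable {R : Type*} [CommRing R]

open PowerSeries

/-- The summand of a limiting case of the `q`-Gauss sum. -/
noncomputable def gaussTerm (a : PowerSeries R) (s m t : ℕ) : PowerSeries R :=
  X ^ ((t + 1).choose 2) * (∏ i ∈ Finset.range t, (a * X ^ s + X ^ (m + i)))
    * invQFactorial R t * invQFactorial R (m + t)

theorem le_choose_succ_two (t : ℕ) : t ≤ (t + 1).choose 2 := by
  rw [Nat.choose_succ_succ', Nat.choose_one_right]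
  exact Nat.le_add_right _ _

theorem X_pow_dvd_gaussTerm (a : PowerSeries R) (s m t : ℕ) : X ^ t ∣ gaussTerm a s m t := by
  simp only [gaussTerm, mul_assoc]
  exact (pow_dvd_pow X (le_choose_succ_two t)).mul_right _

theorem summable_gaussTerm (a : PowerSeries R) (s m : ℕ) : Summable (gaussTerm a s m) :=
  qAdic_summable_of_dvd id (fun d => Set.finite_Iic d) (X_pow_dvd_gaussTerm a s m)

theorem gaussTerm_succ (a : PowerSeries R) (s m t : ℕ) :
    (1 - X ^ (t + 1)) * gaussTerm a s m (t + 1)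
      = X ^ (t + 1) * (a * X ^ s + X ^ (m + t)) * X ^ ((t + 1).choose 2)
        * (∏ i ∈ Finset.range t, (a * X ^ s + X ^ (m + i)))
        * invQFactorial R t * invQFactorial R (m + t + 1) := by
  rw [gaussTerm, Finset.prod_range_succ, invQFactorial_eq_succ t, Nat.choose_succ_succ' (t + 1) 1,
    Nat.choose_one_right, ← add_assoc m t 1]
  ring

theorem gaussTerm_shift (a : PowerSeries R) (s m t : ℕ) :
    gaussTerm a (s + 1) (m + 1) t = X ^ t * X ^ ((t + 1).choose 2)
        * (∏ i ∈ Finset.range t, (a * X ^ s + X ^ (m + i)))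
        * invQFactorial R t * invQFactorial R (m + t + 1) := by
  have h : ∏ i ∈ Finset.range t, (a * X ^ (s + 1) + X ^ (m + 1 + i))
      = X ^ t * ∏ i ∈ Finset.range t, (a * X ^ s + X ^ (m + i)) := by
    rw [← Finset.card_range t, ← Finset.prod_const, Finset.card_range, ← Finset.prod_mul_distrib]
    exact Finset.prod_congr rfl fun i _ => by ring
  rw [gaussTerm, h, show m + 1 + t = m + t + 1 by ring]
  ring

/-- A telescoping certificate: (1 - q^t) times the summand vanishes at t = 0 and tends to 0, so
summing over t yields `tsum_gaussTerm_shift`. -/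
theorem gaussTerm_sub (a : PowerSeries R) (s m t : ℕ) :
    gaussTerm a s m t - (1 + a * X ^ (s + 1)) * gaussTerm a (s + 1) (m + 1) t
      = (1 - X ^ t) * gaussTerm a s m t - (1 - X ^ (t + 1)) * gaussTerm a s m (t + 1) := by
  rw [gaussTerm_succ, gaussTerm_shift, gaussTerm, invQFactorial_eq_succ (m + t)]
  ring

theorem tsum_gaussTerm_shift (a : PowerSeries R) (s m : ℕ) :
    ∑' t, gaussTerm a s m t
      = (1 + a * X ^ (s + 1)) * ∑' t, gaussTerm a (s + 1) (m + 1) t := by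
  have h := ((summable_gaussTerm a s m).hasSum.sub
    ((summable_gaussTerm a (s + 1) (m + 1)).hasSum.mul_left (1 + a * X ^ (s + 1)))).tendsto_sum_nat
  simp only [gaussTerm_sub] at h
  simp only [Finset.sum_range_sub' (fun t => (1 - X ^ t) * gaussTerm a s m t)] at h
  have h0 : Filter.Tendsto (fun t => (1 - X ^ 0) * gaussTerm a s m 0
      - (1 - X ^ t) * gaussTerm a s m t) Filter.atTop (nhds 0) := by
    refine qAdic_tendsto_of_dvd fun n => ?_
    simpa using (X_pow_dvd_gaussTerm a s m n).mul_left (1 - X ^ n)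
  exact sub_eq_zero.1 (tendsto_nhds_unique h h0)

theorem tsum_gaussTerm_shift_iterate (a : PowerSeries R) (s m N : ℕ) :
    ∑' t, gaussTerm a s m t
      = qPoch (-(a * X) * X ^ s) N * ∑' t, gaussTerm a (s + N) (m + N) t := by
  induction N with
  | zero => simp [qPoch_zero]
  | succ N ih =>
    rw [ih, tsum_gaussTerm_shift, qPoch_succ, ← add_assoc, ← add_assoc]
    ring

theorem X_pow_dvd_tsum_gaussTerm_sub (a : PowerSeries R) (s m N : ℕ) :
    X ^ N ∣ qPoch X (m + N) * (∑' t, gaussTerm a (s + N) (m + N) t) - 1 := by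
  have h0 : gaussTerm a (s + N) (m + N) 0 = invQFactorial R (m + N) := by
    simp [gaussTerm, invQFactorial_zero]
  rw [(summable_gaussTerm a _ _).tsum_eq_zero_add, h0, mul_add, qPoch_mul_invQFactorial,
    add_sub_cancel_left]
  refine Dvd.dvd.mul_left (qAdic_dvd_hasSum
    ((summable_nat_add_iff 1).2 (summable_gaussTerm a (s + N) (m + N))).hasSum fun t => ?_) _
  -- Every term past the first contains the i = 0 factor a q^{s+N} + q^{m+N}, which is divisible by
  -- q^N.
  rw [gaussTerm, Finset.prod_range_succ']
  refine Dvd.dvd.mul_right (Dvd.dvd.mul_right (Dvd.dvd.mul_left (Dvd.dvd.mul_left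
    (dvd_add ?_ ?_) _) _) _) _
  · exact Dvd.dvd.mul_left (pow_dvd_pow _ (by omega)) _
  · exact pow_dvd_pow _ (by omega)

/-- Iterating the shift N times extracts a finite product, while the shifted sum times (q;q)_{m+N}
tends to 1; let N tend to infinity. -/
theorem qPochInf_mul_tsum_gaussTerm (a : PowerSeries R) (s m : ℕ) :
    qPochInf X * ∑' t, gaussTerm a s m t = qPochInf (-(a * X) * X ^ s) := by
  have h1 : Filter.Tendsto (fun N => qPoch X (m + N) * ∑' t, gaussTerm a s m t) Filter.atTop
      (nhds (qPochInf X * ∑' t, gaussTerm a s m t)) := by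
    refine Filter.Tendsto.mul_const _ ?_
    simp only [add_comm m]
    exact (tendsto_qPoch X).comp (Filter.tendsto_add_atTop_nat m)
  have h2 := (tendsto_qPoch (-(a * X) * X ^ s)).mul
    (qAdic_tendsto_of_dvd (X_pow_dvd_tsum_gaussTerm_sub a s m))
  rw [mul_one] at h2
  refine tendsto_nhds_unique h1 (h2.congr fun N => ?_)
  rw [tsum_gaussTerm_shift_iterate a s m N]
  ring

theorem choose_add_succ_two (s t : ℕ) :
    (s + t + 1).choose 2 = (s + 1).choose 2 + (t + 1).choose 2 + s * t := by
  induction t with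
  | zero => simp
  | succ t ih =>
    rw [Nat.choose_succ_succ' (s + (t + 1)) 1, Nat.choose_succ_succ' (t + 1) 1,
      ← add_assoc s t 1, ih, Nat.choose_one_right, Nat.choose_one_right]
    ring

/-- The cross term st in binom(s+t+1,2) supplies one q^s to each of the last t factors a + q^{s+i}.
-/
theorem scaledPoch_add_mul (a : PowerSeries R) (s t : ℕ) :
    scaledPoch a (s + t) * X ^ ((s + t + 1).choose 2) * invQFactorial R t
        * invQFactorial R (s + t + s)
      = scaledPoch a s * X ^ ((s + 1).choose 2) * gaussTerm a s (2 * s) t := by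
  have h : ∏ i ∈ Finset.range t, (a * X ^ s + X ^ (2 * s + i))
      = X ^ (s * t) * ∏ i ∈ Finset.range t, (a + X ^ (s + i)) := by
    rw [pow_mul, ← Finset.card_range t, ← Finset.prod_const, Finset.card_range,
      ← Finset.prod_mul_distrib]
    exact Finset.prod_congr rfl fun i _ => by ring
  rw [gaussTerm, h, choose_add_succ_two, scaledPoch, scaledPoch, Finset.prod_range_add,
    show s + t + s = 2 * s + t by ring]
  ring

/-- The conjugate Bailey pair relative to `1` with parameters `-1/a` and infinity. -/
theorem hasSum_conjugate_bailey (a : PowerSeries R) (s : ℕ) :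
    HasSum (fun t => scaledPoch a (s + t) * X ^ ((s + t + 1).choose 2) * invQFactorial R t
        * invQFactorial R (s + t + s))
      (qPochInf (-(a * X)) * recip (qPochInf X) * (scaledPoch a s * X ^ ((s + 1).choose 2)
        * recip (qPoch (-(a * X)) s))) := by
  simp only [scaledPoch_add_mul]
  have h := qPochInf_mul_tsum_gaussTerm a s (2 * s)
  have hX := mul_recip (qPochInf (X : PowerSeries R)) (constantCoeff_qPochInf (by simp))
  have ha := mul_recip (qPoch (-(a * X)) s) (constantCoeff_qPoch _ (by simp) s)
  have hsum : ∑' t, gaussTerm a s (2 * s) t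
      = qPochInf (-(a * X)) * recip (qPochInf X) * recip (qPoch (-(a * X)) s) := by
    rw [qPochInf_eq_mul (-(a * X)) s, ← h]
    linear_combination (-(∑' t, gaussTerm a s (2 * s) t)) * hX
      - (∑' t, gaussTerm a s (2 * s) t) * (qPochInf X * recip (qPochInf X)) * ha
  have hmul := (summable_gaussTerm a s (2 * s)).hasSum.mul_left
    (scaledPoch a s * X ^ ((s + 1).choose 2))
  rw [hsum] at hmul
  rwa [show qPochInf (-(a * X)) * recip (qPochInf X) * (scaledPoch a s * X ^ ((s + 1).choose 2)
      * recip (qPoch (-(a * X)) s)) = scaledPoch a s * X ^ ((s + 1).choose 2)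
      * (qPochInf (-(a * X)) * recip (qPochInf X) * recip (qPoch (-(a * X)) s)) by ring]

end ConjugateBailey

/-! ### Summation over chains with a prescribed largest entry. -/

section Chains

/-- The chains `N = n_1 ≥ ⋯ ≥ n_{r+1} ≥ 1`. -/
def chainsFrom : (r N : ℕ) → Finset (Fin (r + 1) → ℕ)
  | 0, N => if N = 0 then ∅ else {fun _ => N}
  | r + 1, N => (Finset.range N).biUnion fun j =>
      (chainsFrom r (j + 1)).image fun c => (Fin.cons N c : Fin (r + 2) → ℕ)

theorem mem_chainsFrom {r N : ℕ} {c : Fin (r + 1) → ℕ} :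
    c ∈ chainsFrom r N ↔ (Antitone c ∧ ∀ i, 1 ≤ c i) ∧ c 0 = N := by
  induction r generalizing N with
  | zero =>
    have hanti : Antitone c := fun i j _ => by rw [Subsingleton.elim (α := Fin 1) i j]
    rw [chainsFrom]
    constructor
    · intro h
      split_ifs at h with hN
      · simp at h
      · rw [Finset.mem_singleton] at h
        subst h
        exact ⟨⟨hanti, fun _ => Nat.one_le_iff_ne_zero.2 hN⟩, rfl⟩
    · rintro ⟨⟨-, h1⟩, rfl⟩
      rw [if_neg (Nat.one_le_iff_ne_zero.1 (h1 0)), Finset.mem_singleton]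
      exact funext fun i => by rw [Subsingleton.elim (α := Fin 1) i 0]
  | succ r ih =>
    simp only [chainsFrom, Finset.mem_biUnion, Finset.mem_image, Finset.mem_range]
    constructor
    · rintro ⟨j, hj, c', hc', rfl⟩
      obtain ⟨⟨h1, h2⟩, h3⟩ := ih.1 hc'
      refine ⟨⟨?_, ?_⟩, rfl⟩
      · refine Fin.antitone_iff_succ_le.2 fun i => ?_
        refine Fin.cases ?_ (fun i => ?_) i
        · simp only [Fin.cons_succ, Fin.castSucc_zero, Fin.cons_zero]
          omega
        · simp only [Fin.cons_succ, Fin.castSucc_succ]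
          exact h1 (Fin.castSucc_le_succ i)
      · refine Fin.cases ?_ (fun i => ?_)
        · simp only [Fin.cons_zero]
          omega
        · simpa using h2 i
    · rintro ⟨⟨h1, h2⟩, rfl⟩
      have h3 : 1 ≤ c (Fin.succ 0) := h2 _
      have h4 : c (Fin.succ 0) ≤ c 0 := h1 (Fin.zero_le _)
      refine ⟨c (Fin.succ 0) - 1, by omega, Fin.tail c, ih.2 ⟨⟨?_, ?_⟩, ?_⟩, ?_⟩
      · exact fun i j hij => h1 (Fin.succ_le_succ_iff.2 hij)
      · exact fun i => h2 _
      · simp only [Fin.tail]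
        omega
      · exact Fin.cons_self_tail c

variable {R : Type*} [CommRing R]

open PowerSeries

/-- The part of `multisumTerm` that does not involve `a`, apart from `q ^ (n_1 + 1).choose 2`. -/
noncomputable def chainWeight (z z' : PowerSeries R) (r : ℕ) (c : Fin (r + 1) → ℕ) :
    PowerSeries R :=
  X ^ (∑ i : Fin r, c i.succ ^ 2)
    * recip ((∏ i : Fin r, qPoch X (c i.castSucc - c i.succ))
        * (qPoch (z * X) (c (Fin.last r)) * qPoch (z' * X) (c (Fin.last r))))

/-- The head of a chain carries no square in the weight; its square appears only once a larger entry
is put in front, giving exactly the weight in `bailey_step`. -/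
theorem chainWeight_cons (z z' : PowerSeries R) (r N : ℕ) (c : Fin (r + 1) → ℕ) :
    chainWeight z z' (r + 1) (Fin.cons N c)
      = X ^ (c 0 ^ 2) * invQFactorial R (N - c 0) * chainWeight z z' r c := by
  simp only [chainWeight, Fin.sum_univ_succ, Fin.prod_univ_succ, Fin.cons_succ, Fin.castSucc_zero,
    Fin.cons_zero, Fin.castSucc_succ, ← Fin.succ_last, mul_assoc, invQFactorial]
  rw [recip_mul (constantCoeff_qPoch_X _)
    (by simp [map_prod, constantCoeff_qPoch_X, constantCoeff_qPoch_mul_X]), pow_add]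
  ring

theorem sum_chainsFrom_succ {M : Type*} [AddCommMonoid M] (r N : ℕ)
    (f : (Fin (r + 2) → ℕ) → M) :
    ∑ c ∈ chainsFrom (r + 1) N, f c
      = ∑ j ∈ Finset.range N, ∑ c ∈ chainsFrom r (j + 1), f (Fin.cons N c) := by
  rw [chainsFrom, Finset.sum_biUnion]
  · refine Finset.sum_congr rfl fun j _ => Finset.sum_image fun c _ c' _ h => ?_
    exact Fin.cons_right_injective _ h
  · intro i _ j _ hij
    refine Finset.disjoint_left.2 fun c hi hj => hij ?_
    obtain ⟨c₁, h₁, rfl⟩ := Finset.mem_image.1 hi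
    obtain ⟨c₂, h₂, h⟩ := Finset.mem_image.1 hj
    obtain rfl := Fin.cons_right_injective _ h
    have := (mem_chainsFrom.1 h₁).2
    have := (mem_chainsFrom.1 h₂).2
    omega

/-- The Bailey chain iterated r times from the partial fraction expansion. -/
theorem sum_chainWeight {z z' : PowerSeries R} (hz : z * z' = 1) (r n : ℕ) :
    ∑ c ∈ chainsFrom r (n + 1), chainWeight z z' r c
      = ∑ i ∈ Finset.range (n + 1), X ^ (r * (i + 1) ^ 2) * rankAlpha z z' i
        * invQFactorial R (n + 1 - (i + 1)) * invQFactorial R (n + 1 + (i + 1)) := by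
  induction r generalizing n with
  | zero => simp [chainsFrom, chainWeight, recip_qPoch_mul_qPoch hz]
  | succ r ih =>
    rw [sum_chainsFrom_succ]
    calc _ = ∑ j ∈ Finset.range (n + 1), X ^ ((j + 1) ^ 2) * invQFactorial R (n + 1 - (j + 1))
        * ∑ i ∈ Finset.range (j + 1), X ^ (r * (i + 1) ^ 2) * rankAlpha z z' i
            * invQFactorial R (j + 1 - (i + 1)) * invQFactorial R (j + 1 + (i + 1)) := by
          refine Finset.sum_congr rfl fun j _ => ?_
          rw [← ih, Finset.mul_sum]
          refine Finset.sum_congr rfl fun c hc => ?_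
          rw [chainWeight_cons, (mem_chainsFrom.1 hc).2]
      _ = _ := by
          rw [bailey_step (fun i => X ^ (r * (i + 1) ^ 2) * rankAlpha z z' i)]
          exact Finset.sum_congr rfl fun i _ => by ring

theorem finite_chains_le (r d : ℕ) : {c : ChainIndex r | c.1 0 ≤ d}.Finite := by
  refine Set.Finite.subset ((Set.finite_Iic (fun _ : Fin (r + 1) => d)).preimage
    Subtype.val_injective.injOn) fun c hc i => ?_
  exact (c.2.1 (Fin.zero_le i)).trans hc

/-- Sorting the chains by their largest entry. -/
theorem hasSum_chains_fiber {r : ℕ} {f : (Fin (r + 1) → ℕ) → PowerSeries R} {s : PowerSeries R}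
    (h : HasSum (fun c : ChainIndex r => f c.1) s) :
    HasSum (fun n => ∑ c ∈ chainsFrom r (n + 1), f c) s := by
  have hfiber : ∀ N, HasSum (fun c : {c : ChainIndex r // c.1 0 = N} => f c.1.1)
      (∑ c ∈ chainsFrom r N, f c) := by
    intro N
    let e : {c : ChainIndex r // c.1 0 = N} ≃ {c // c ∈ chainsFrom r N} :=
      { toFun := fun c => ⟨c.1.1, mem_chainsFrom.2 ⟨c.1.2, c.2⟩⟩
        invFun := fun c => ⟨⟨c.1, (mem_chainsFrom.1 c.2).1⟩, (mem_chainsFrom.1 c.2).2⟩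
        left_inv := fun _ => rfl
        right_inv := fun _ => rfl }
    have := e.hasSum_iff.2 ((chainsFrom r N).hasSum f)
    exact this
  have h1 : HasSum (fun N => ∑ c ∈ chainsFrom r N, f c) s :=
    HasSum.sigma (((Equiv.sigmaFiberEquiv fun c : ChainIndex r => c.1 0).hasSum_iff).2 h) hfiber
  -- The fibre over 0 is empty, so starting the sum at 1 loses nothing.
  have h0 : chainsFrom r 0 = ∅ := by
    refine Finset.eq_empty_of_forall_notMem fun c hc => ?_
    obtain ⟨⟨_, h2⟩, h3⟩ := mem_chainsFrom.1 hc
    exact absurd (h2 0) (by omega)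
  have h2 := (hasSum_nat_add_iff' 1).2 h1
  simpa [h0] using h2

end Chains

/-! ### From the multisum to a single series in which z still occurs. -/

section Multisum

variable {R : Type*} [CommRing R]

open PowerSeries

/-- The Lambert-type summand with `z` still present, indexed from `n = 1`. -/
noncomputable def rankTerm (a z z' : PowerSeries R) (r i : ℕ) : PowerSeries R :=
  scaledPoch a (i + 1) * X ^ ((i + 1 + 1).choose 2) * recip (qPoch (-(a * X)) (i + 1))
    * (X ^ (r * (i + 1) ^ 2) * rankAlpha z z' i)

/-- Bailey's lemma as a double series summed two ways: along antidiagonals it is the sum over chains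
sorted by n_1, along rows it is evaluated by the conjugate Bailey pair. -/
theorem hasSum_rankTerm {a z z' : PowerSeries R} (hz : z * z' = 1) (r : ℕ) {s : PowerSeries R}
    (h : HasSum (fun c : ChainIndex r =>
      scaledPoch a (c.1 0) * X ^ ((c.1 0 + 1).choose 2) * chainWeight z z' r c.1) s) :
    HasSum (fun i => qPochInf (-(a * X)) * recip (qPochInf X) * rankTerm a z z' r i) s := by
  -- Here `p.1 + 1` is the index s of α, and `p.2` is n_1 - s.
  let G : ℕ × ℕ → PowerSeries R := fun p => X ^ (r * (p.1 + 1) ^ 2) * rankAlpha z z' p.1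
    * (scaledPoch a (p.1 + 1 + p.2) * X ^ ((p.1 + 1 + p.2 + 1).choose 2) * invQFactorial R p.2
        * invQFactorial R (p.1 + 1 + p.2 + (p.1 + 1)))
  have hG : Summable G := by
    refine qAdic_summable_of_dvd (fun p => p.1 + p.2) (fun d => ?_) fun p => ?_
    · refine ((Set.finite_Iic d).prod (Set.finite_Iic d)).subset fun p hp => ?_
      have : p.1 + p.2 ≤ d := hp
      exact ⟨Set.mem_Iic.2 (by omega), Set.mem_Iic.2 (by omega)⟩
    · refine Dvd.dvd.mul_left (Dvd.dvd.mul_right (Dvd.dvd.mul_right (Dvd.dvd.mul_left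
        (pow_dvd_pow _ ?_) _) _) _) _
      exact le_trans (by omega) (le_choose_succ_two _)
  have h1 : HasSum (fun n => ∑ p ∈ Finset.HasAntidiagonal.antidiagonal n, G p) (∑' p, G p) :=
    HasSum.sigma (Finset.HasAntidiagonal.sigmaAntidiagonalEquivProd.hasSum_iff.2 hG.hasSum)
      fun n => (Finset.HasAntidiagonal.antidiagonal n).hasSum G
  have h2 := hasSum_chains_fiber (r := r)
    (f := fun c => scaledPoch a (c 0) * X ^ ((c 0 + 1).choose 2) * chainWeight z z' r c) h
  have h3 : ∀ n, ∑ c ∈ chainsFrom r (n + 1),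
      scaledPoch a (c 0) * X ^ ((c 0 + 1).choose 2) * chainWeight z z' r c
      = ∑ p ∈ Finset.HasAntidiagonal.antidiagonal n, G p := by
    intro n
    rw [Finset.Nat.sum_antidiagonal_eq_sum_range_succ_mk]
    calc _ = scaledPoch a (n + 1) * X ^ ((n + 1 + 1).choose 2)
          * ∑ c ∈ chainsFrom r (n + 1), chainWeight z z' r c := by
          rw [Finset.mul_sum]
          exact Finset.sum_congr rfl fun c hc => by rw [(mem_chainsFrom.1 hc).2]
      _ = _ := by
          rw [sum_chainWeight hz, Finset.mul_sum]
          refine Finset.sum_congr rfl fun i hi => ?_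
          obtain ⟨t, rfl⟩ : ∃ t, n = i + t := Nat.exists_eq_add_of_le (by
            have := Finset.mem_range.1 hi; omega)
          simp only [G]
          rw [show i + t + 1 - (i + 1) = t by omega, show i + t - i = t by omega,
            show i + t + 1 = i + 1 + t by ring]
          ring
  simp only [h3] at h2
  rw [h2.unique h1]
  refine hG.hasSum.prod_fiberwise fun i => ?_
  have h4 := (hasSum_conjugate_bailey a (i + 1)).mul_left
    (X ^ (r * (i + 1) ^ 2) * rankAlpha z z' i)
  rwa [show X ^ (r * (i + 1) ^ 2) * rankAlpha z z' i * (qPochInf (-(a * X)) * recip (qPochInf X)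
      * (scaledPoch a (i + 1) * X ^ ((i + 1 + 1).choose 2) * recip (qPoch (-(a * X)) (i + 1))))
      = qPochInf (-(a * X)) * recip (qPochInf X) * rankTerm a z z' r i by
        rw [rankTerm]; ring] at h4

theorem hasSum_geometric {y : PowerSeries R} (hy : constantCoeff y = 0) :
    HasSum (fun n : ℕ => y ^ n) (recip (1 - y)) := by
  let _ : TopologicalSpace R := ⊥
  have : DiscreteTopology R := ⟨rfl⟩
  rw [recip_eq_of_mul_eq_one (by simp [hy])
    (WithPiTopology.one_sub_mul_tsum_pow_of_constantCoeff_eq_zero hy)]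
  exact (WithPiTopology.summable_pow_of_constantCoeff_eq_zero hy).hasSum

end Multisum

/-! ### Expansion in powers of z and the counting generating function. -/

section GeneratingFunction

open PowerSeries

/-- The inclusion `ℤ[a]⟦q⟧ → ℤ[a][z, z⁻¹]⟦q⟧`. -/
noncomputable abbrev toGenSeries : PowerSeries (Polynomial ℤ) →+* GenSeries :=
  PowerSeries.map LaurentPolynomial.C

theorem zPow_add (m n : ℤ) : zPow (m + n) = zPow m * zPow n := by
  rw [zPow, zPow, zPow, LaurentPolynomial.T_add, map_mul]

theorem zPow_zero : zPow 0 = 1 := by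
  rw [zPow, LaurentPolynomial.T_zero, map_one]

theorem zPow_one_mul_zPow_neg_one : zPow 1 * zPow (-1) = 1 := by
  rw [← zPow_add, add_neg_cancel, zPow_zero]

theorem zPow_one_pow (n : ℕ) : zPow 1 ^ n = zPow n := by
  simp [zPow, ← map_pow, LaurentPolynomial.T_pow]

theorem zPow_neg_one_pow (n : ℕ) : zPow (-1) ^ n = zPow (-n) := by
  simp [zPow, ← map_pow, LaurentPolynomial.T_pow]

theorem hasSum_int_geometric {R : Type*} [CommRing R] {y y' : PowerSeries R}
    (hy : constantCoeff y = 0) (hy' : constantCoeff y' = 0) {f : ℤ → PowerSeries R}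
    (hf : ∀ k : ℕ, f k = y ^ k) (hf' : ∀ k : ℕ, f (-(k + 1)) = y' ^ (k + 1)) :
    HasSum f (recip (1 - y) + y' * recip (1 - y')) := by
  refine HasSum.of_nat_of_neg_add_one ?_ ?_
  · simp only [hf]
    exact hasSum_geometric hy
  · simp only [hf', pow_succ']
    exact (hasSum_geometric hy').mul_left y'

theorem recip_add_mul_recip {R : Type*} [CommRing R] {y y' : PowerSeries R}
    (hy : constantCoeff y = 0) (hy' : constantCoeff y' = 0) :
    recip (1 - y) + y' * recip (1 - y') = (1 - y * y') * recip ((1 - y) * (1 - y')) := by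
  have c1 : constantCoeff (1 - y) = 1 := by simp [hy]
  have c2 : constantCoeff (1 - y') = 1 := by simp [hy']
  rw [recip_mul c1 c2]
  linear_combination (-recip (1 - y)) * mul_recip _ c2 - y' * recip (1 - y') * mul_recip _ c1

/-- The terms m ≥ 0 and m < 0 form geometric series in y = zq^{n+1} and y' = z⁻¹q^{n+1}; over a
common denominator the numerator is 1 - yy', a factor already present in α. -/
theorem hasSum_bilateral_geometric (n : ℕ) :
    HasSum (fun m : ℤ => zPow m * X ^ (m.natAbs * (n + 1)))
      ((1 - X ^ (2 * (n + 1))) * recip (rankFactor (zPow 1) (zPow (-1)) (n + 1))) := by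
  have hy : ∀ m, constantCoeff (zPow m * X ^ (n + 1)) = 0 := fun m => by simp
  have e : zPow 1 * X ^ (n + 1) * (zPow (-1) * X ^ (n + 1)) = X ^ (2 * (n + 1)) := by
    rw [mul_mul_mul_comm, zPow_one_mul_zPow_neg_one, one_mul, ← pow_add, two_mul]
  rw [rankFactor, ← e, ← recip_add_mul_recip (hy 1) (hy (-1))]
  refine hasSum_int_geometric (hy 1) (hy (-1)) (fun k => ?_) fun k => ?_
  · rw [mul_pow, zPow_one_pow, ← pow_mul, Int.natAbs_natCast, mul_comm k]
  · have hk : (-((k : ℤ) + 1)).natAbs = k + 1 := by omega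
    rw [mul_pow, zPow_neg_one_pow, ← pow_mul, hk, mul_comm (k + 1), Nat.cast_add, Nat.cast_one]

theorem toGenSeries_lambertTerm (r : ℕ) (m : ℤ) (i : ℕ) :
    toGenSeries (lambertTerm (r + 2) m (i + 1))
      = (-1) ^ i * X ^ ((r + 1) * (i + 1) ^ 2 + m.natAbs * (i + 1)) * (1 - X ^ (i + 1))
        * scaledPoch aVar (i + 1) * recip (qPoch (-(aVar * X)) (i + 1)) := by
  rw [lambertTerm, map_mul, map_recip _ (constantCoeff_qPoch _ (by simp) _)]
  simp [map_scaledPoch, map_qPoch, aVar]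

theorem hasSum_toGenSeries_lambertTerm (r i : ℕ) :
    HasSum (fun m : ℤ => toGenSeries (lambertTerm (r + 2) m (i + 1)) * zPow m)
      (rankTerm aVar (zPow 1) (zPow (-1)) r i) := by
  have h := (hasSum_bilateral_geometric i).mul_left ((-1) ^ i * X ^ ((r + 1) * (i + 1) ^ 2)
    * (1 - X ^ (i + 1)) * scaledPoch aVar (i + 1) * recip (qPoch (-(aVar * X)) (i + 1)))
  -- One binomial comes from the conjugate pair, the other from α; together they give the last
  -- square, raising r to r + 1 = k - 1.
  have hexp : (i + 1 + 1).choose 2 + (i + 1).choose 2 = (i + 1) ^ 2 := by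
    clear h
    induction i with
    | zero => rfl
    | succ i ih =>
      rw [Nat.choose_succ_succ' (i + 1 + 1) 1, Nat.choose_succ_succ' (i + 1) 1,
        Nat.choose_one_right, Nat.choose_one_right] at *
      linarith
  have hrank : rankTerm aVar (zPow 1) (zPow (-1)) r i = (-1) ^ i * X ^ ((r + 1) * (i + 1) ^ 2)
      * (1 - X ^ (i + 1)) * scaledPoch aVar (i + 1) * recip (qPoch (-(aVar * X)) (i + 1))
      * ((1 - X ^ (2 * (i + 1))) * recip (rankFactor (zPow 1) (zPow (-1)) (i + 1))) := by
    rw [rankTerm, rankAlpha, add_mul, one_mul, pow_add, ← hexp, pow_add]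
    ring
  rw [hrank]
  refine h.congr_fun fun m => ?_
  rw [toGenSeries_lambertTerm, pow_add]
  ring

/-- A bound growing in m and i jointly makes the double series summable, and it forces the counts to
vanish when |m| > n. -/
theorem X_pow_dvd_lambertTerm (r : ℕ) (m : ℤ) (i : ℕ) :
    X ^ (m.natAbs + i) ∣ lambertTerm (r + 2) m (i + 1) := by
  rw [lambertTerm]
  refine Dvd.dvd.mul_right (Dvd.dvd.mul_right (Dvd.dvd.mul_right (Dvd.dvd.mul_left
    (pow_dvd_pow _ ?_) _) _) _) _
  have h1 : i ≤ (r + 2 - 1) * (i + 1) ^ 2 := by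
    rw [show r + 2 - 1 = r + 1 by omega]
    nlinarith [Nat.zero_le (r * (i + 1) ^ 2)]
  have h2 : m.natAbs ≤ m.natAbs * (i + 1) := Nat.le_mul_of_pos_right _ i.succ_pos
  omega

theorem X_pow_dvd_overRankSeries (r : ℕ) (m : ℤ) :
    X ^ m.natAbs ∣ overRankSeries (r + 2) m :=
  Dvd.dvd.mul_left (qAdic_dvd_hasSum (summable_lambertTerm (r + 2) (by omega) m).hasSum fun i =>
    (pow_dvd_pow X (Nat.le_add_right _ i)).trans (X_pow_dvd_lambertTerm r m i)) _

theorem natAbs_le_of_overRankCount_ne_zero {r : ℕ} {m : ℤ} {n j : ℕ}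
    (h : overRankCount (r + 2) m n j ≠ 0) : m.natAbs ≤ n := by
  by_contra hlt
  refine h ?_
  rw [overRankCount, X_pow_dvd_iff.1 (X_pow_dvd_overRankSeries r m) n (not_le.1 hlt),
    Polynomial.coeff_zero]

theorem hasSum_toGenSeries_overRankSeries (r : ℕ) (m : ℤ) :
    HasSum (fun i => qPochInf (-(aVar * X)) * recip (qPochInf X)
        * toGenSeries (lambertTerm (r + 2) m (i + 1)))
      (toGenSeries (overRankSeries (r + 2) m)) := by
  have h := ((summable_lambertTerm (r + 2) (by omega) m).hasSum.map toGenSeries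
    (qAdic_continuous_map LaurentPolynomial.C)).mul_left
    (qPochInf (-(aVar * X)) * recip (qPochInf X))
  have e : toGenSeries (overRankSeries (r + 2) m)
      = qPochInf (-(aVar * X)) * recip (qPochInf X)
        * toGenSeries (∑' n : ℕ, lambertTerm (r + 2) m (n + 1)) := by
    rw [overRankSeries, map_mul, map_mul, map_recip _ (constantCoeff_qPochInf (by simp)),
      map_qPochInf, map_qPochInf]
    simp [aVar]
  rw [e]
  exact h

theorem finite_natAbs_add_le (d : ℕ) : {p : ℤ × ℕ | p.1.natAbs + p.2 ≤ d}.Finite := by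
  refine ((Set.finite_Icc (-(d : ℤ)) d).prod (Set.finite_Iic d)).subset fun p hp => ?_
  have : p.1.natAbs + p.2 ≤ d := hp
  exact ⟨Set.mem_Icc.2 (by omega), Set.mem_Iic.2 (by omega)⟩

/-- The double sum of Lambert-type terms, summed in either order. -/
theorem hasSum_overRankSeries_mul_zPow {r : ℕ} {s : GenSeries}
    (h : HasSum (fun i => qPochInf (-(aVar * X)) * recip (qPochInf X)
      * rankTerm aVar (zPow 1) (zPow (-1)) r i) s) :
    HasSum (fun m : ℤ => toGenSeries (overRankSeries (r + 2) m) * zPow m) s := by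
  let K : ℤ × ℕ → GenSeries := fun p => qPochInf (-(aVar * X)) * recip (qPochInf X)
    * toGenSeries (lambertTerm (r + 2) p.1 (p.2 + 1)) * zPow p.1
  have hK : Summable K := by
    refine qAdic_summable_of_dvd (fun p => p.1.natAbs + p.2) finite_natAbs_add_le fun p => ?_
    refine Dvd.dvd.mul_right (Dvd.dvd.mul_left ?_ _) _
    simpa using map_dvd toGenSeries (X_pow_dvd_lambertTerm r p.1 p.2)
  have h1 : HasSum (fun m : ℤ => toGenSeries (overRankSeries (r + 2) m) * zPow m) (∑' p, K p) :=
    hK.hasSum.prod_fiberwise fun m => (hasSum_toGenSeries_overRankSeries r m).mul_right (zPow m)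
  have h2 : HasSum (fun i => qPochInf (-(aVar * X)) * recip (qPochInf X)
      * rankTerm aVar (zPow 1) (zPow (-1)) r i) (∑' p, K p) := by
    refine HasSum.prod_fiberwise ((Equiv.prodComm ℕ ℤ).hasSum_iff.2 hK.hasSum) fun i => ?_
    refine ((hasSum_toGenSeries_lambertTerm r i).mul_left
      (qPochInf (-(aVar * X)) * recip (qPochInf X))).congr_fun fun m => ?_
    simp only [K, Function.comp_apply, Equiv.prodComm_apply, Prod.swap_prod_mk]
    ring
  rwa [h.unique h2]

theorem overRankCount_term_eq (k : ℕ) (p : ℤ × ℕ × ℕ) :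
    (overRankCount k p.1 p.2.1 p.2.2 : GenSeries) * aVar ^ p.2.2 * qVar ^ p.2.1 * zPow p.1
      = C ((overRankCount k p.1 p.2.1 p.2.2 : LaurentPolynomial (Polynomial ℤ))
          * LaurentPolynomial.C Polynomial.X ^ p.2.2 * LaurentPolynomial.T p.1) * X ^ p.2.1 := by
  simp only [aVar, qVar, zPow, map_mul, map_pow, map_intCast]
  ring

/-- Only n = d contributes; then |m| ≤ d, and j lies in the support of one polynomial in a for each
m. -/
theorem finite_coeff_overRankCount_ne_zero (r d : ℕ) : {p : ℤ × ℕ × ℕ |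
    coeff d ((overRankCount (r + 2) p.1 p.2.1 p.2.2 : GenSeries) * aVar ^ p.2.2 * qVar ^ p.2.1
      * zPow p.1) ≠ 0}.Finite := by
  refine Set.Finite.subset (Set.Finite.biUnion (Set.finite_Icc (-(d : ℤ)) d) fun m _ =>
    ((coeff d (overRankSeries (r + 2) m)).support.finite_toSet.image
      fun j => ((m, d, j) : ℤ × ℕ × ℕ))) ?_
  rintro ⟨m, n, j⟩ hp
  simp only [Set.mem_ofPred_eq, overRankCount_term_eq, coeff_C_mul, coeff_X_pow] at hp
  have hd : d = n := by
    by_contra hne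
    simp [hne] at hp
  subst hd
  have hN : overRankCount (r + 2) m d j ≠ 0 := by
    intro h0
    simp [h0] at hp
  have := natAbs_le_of_overRankCount_ne_zero hN
  refine Set.mem_biUnion (x := m) (Set.mem_Icc.2 (by omega)) ⟨j, ?_, rfl⟩
  exact Polynomial.mem_support_iff.2 hN

theorem hasSum_overRankCount_pow (k : ℕ) (m : ℤ) (n : ℕ) :
    HasSum (fun j => (overRankCount k m n j : GenSeries) * aVar ^ j)
      (C (LaurentPolynomial.C (coeff n (overRankSeries k m)))) := by
  have h : C (LaurentPolynomial.C (coeff n (overRankSeries k m)))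
      = ∑ j ∈ (coeff n (overRankSeries k m)).support,
        (overRankCount k m n j : GenSeries) * aVar ^ j := by
    conv_lhs => rw [(coeff n (overRankSeries k m)).as_sum_support_C_mul_X_pow]
    simp [aVar, overRankCount]
  rw [h]
  refine hasSum_sum_of_ne_finset_zero fun j hj => ?_
  rw [overRankCount, Polynomial.notMem_support_iff.1 hj, Int.cast_zero, zero_mul]

theorem hasSum_overRankCount_series (r : ℕ) (m : ℤ) :
    HasSum (fun p : ℕ × ℕ => (overRankCount (r + 2) m p.1 p.2 : GenSeries) * aVar ^ p.2
      * qVar ^ p.1 * zPow m) (toGenSeries (overRankSeries (r + 2) m) * zPow m) := by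
  have hs : Summable fun p : ℕ × ℕ => (overRankCount (r + 2) m p.1 p.2 : GenSeries)
      * aVar ^ p.2 * qVar ^ p.1 * zPow m :=
    qAdic_summable fun d => (finite_coeff_overRankCount_ne_zero r d).preimage
      (Prod.mk_right_injective m).injOn
  have h1 := hs.hasSum.prod_fiberwise fun n =>
    ((hasSum_overRankCount_pow (r + 2) m n).mul_right (qVar ^ n)).mul_right (zPow m)
  have h2 := (qAdic_hasSum_coeff_mul_X_pow (toGenSeries (overRankSeries (r + 2) m))).mul_right (zPow m)
  simp only [coeff_map] at h2
  rw [h2.unique h1]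
  exact hs.hasSum

theorem multisumTerm_eq (r : ℕ) (c : Fin (r + 1) → ℕ) :
    multisumTerm r c = scaledPoch aVar (c 0) * X ^ ((c 0 + 1).choose 2)
      * chainWeight (zPow 1) (zPow (-1)) r c := by
  rw [multisumTerm, chainWeight, qVar, pow_add]
  ring

theorem summable_multisumTerm (r : ℕ) :
    Summable fun n : ChainIndex r => multisumTerm r n.1 := by
  refine qAdic_summable_of_dvd (fun n => n.1 0) (finite_chains_le r) fun n => ?_
  rw [multisumTerm_eq]
  exact Dvd.dvd.mul_right (Dvd.dvd.mul_left (pow_dvd_pow _ (le_choose_succ_two _)) _) _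

end GeneratingFunction

theorem theorem1p2 (k : ℕ) (hk : 2 ≤ k) :
    (Summable fun p : ℤ × ℕ × ℕ =>
      (overRankCount k p.1 p.2.1 p.2.2 : GenSeries) * aVar ^ p.2.2 * qVar ^ p.2.1 * zPow p.1) ∧
    (Summable fun n : ChainIndex (k - 2) => multisumTerm (k - 2) n.1) ∧
    ∑' p : ℤ × ℕ × ℕ,
        (overRankCount k p.1 p.2.1 p.2.2 : GenSeries) * aVar ^ p.2.2 * qVar ^ p.2.1 * zPow p.1
      = ∑' n : ChainIndex (k - 2), multisumTerm (k - 2) n.1 := by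
  obtain ⟨r, rfl⟩ : ∃ r, k = r + 2 := Nat.exists_eq_add_of_le' hk
  rw [Nat.add_sub_cancel]
  have hL := qAdic_summable (finite_coeff_overRankCount_ne_zero r)
  have hR := summable_multisumTerm r
  refine ⟨hL, hR, ?_⟩
  have h1 := hR.hasSum
  simp only [multisumTerm_eq] at h1 ⊢
  have h2 := hasSum_overRankSeries_mul_zPow (hasSum_rankTerm zPow_one_mul_zPow_neg_one r h1)
  exact (hL.hasSum.prod_fiberwise fun m => hasSum_overRankCount_series r m).unique h2
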